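/- Let $F$ be a field with algebraic closure $\overline{F}$ and let $k\ge 1$. A polynomial $P(x_1,\dots,x_k)$ with integer coefficients is said to vanish at $\alpha\in\overline{F}^k$ to order (at least) $v$ if the polynomial $P(\alpha+z)\in\overline{F}[z_1,\dots,z_k]$ has no monomials of total degree less than $v$ (equivalently, all Hasse derivatives of $P$ of order less than $v$ vanish at $\alpha$). (1) Let $\alpha=(\alpha_1,\dots,\alpha_k)\in\overline{F}^k$, and let $P(x_1,\dots,x_k)$ be a homogeneous polynomial with integer coefficients such that $P$ vanishes at $\alpha$ to an order exceeding $\frac{k-1}{k}\deg P$ and $P(1,\dots,1)=1$. Then there exists a linear homogeneous polynomial $Q(x_1,\dots,x_k)$ with integer coefficients such that $Q$ vanishes at $\alpha$ and $Q(1,\dots,1)=1$. (2) The bound on the order of vanishing is sharp, for every $F$ and every $k\ge 1$: there exist a point $\alpha\in\overline{F}^k$ and a homogeneous polynomial $P(x_1,\dots,x_k)$ of degree $k$ with integer coefficients such that $P(1,\dots,1)=1$ and $P$ vanishes at $\alpha$ to order exactly $k-1=\frac{k-1}{k}\deg P$, but there is no linear homogeneous polynomial $Q(x_1,\dots,x_k)$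 with integer coefficients that vanishes at $\alpha$ and satisfies $Q(1,\dots,1)=1$. -/

import Mathlib

open MvPolynomial

/-- The polynomial `P(α + z)` in the variables `z`, with coefficients in the `R`-algebra `K`.
The coefficient of `z ^ m` is the value at `α` of the Hasse derivative of `P` of multi-index `m`. -/
noncomputable def taylorExpansionAt {σ R K : Type*} [CommRing R] [CommRing K] [Algebra R K]
    (P : MvPolynomial σ R) (α : σ → K) : MvPolynomial σ K :=
  MvPolynomial.aeval (fun i => MvPolynomial.C (α i) + MvPolynomial.X i) P

/-- `P` vanishes at `α` to order (at least) `v`: the expansion `P(α + z)` has no monomials of total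
degree less than `v`, that is, all Hasse derivatives of `P` of order less than `v` vanish at `α`. -/
def VanishesToOrder {σ R K : Type*} [CommRing R] [CommRing K] [Algebra R K]
    (P : MvPolynomial σ R) (α : σ → K) (v : ℕ) : Prop :=
  ∀ m : σ →₀ ℕ, m.degree < v → MvPolynomial.coeff m (taylorExpansionAt P α) = 0

/-- There is a homogeneous linear polynomial `Q` with integer coefficients such that `Q` vanishes
at `α` and `Q(1, …, 1) = 1`. -/
def HasPrimitiveLinearRelation {k : ℕ} {K : Type*} [CommRing K] (α : Fin k → K) : Prop :=
  ∃ Q : MvPolynomial (Fin k) ℤ,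
    Q.IsHomogeneous 1 ∧ MvPolynomial.aeval α Q = 0 ∧ MvPolynomial.eval (fun _ => 1) Q = 1

/-! Part (1), in `n` variables. Restrict `P` to the span of at most `n` points where it vanishes to
order `v`: each `t i` has exponent at most `d - v`, so a surviving monomial has degree at most `n *
(d - v) < d`, and `P` is zero on the span (`aeval_sum_smul_eq_zero`). Over a prime field `k`, apply
this to the specializations of `α` in the algebraic closure of `k`. A point `w` over `k` with `P(w)
≠ 0` is outside their span, and Galois descent gives a relation of `α` over `k` that fails at `w`
(`exists_relation_of_vanishesToOrder`). The coefficient sums of the integral relations form an ideal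
of `ℤ`, so it suffices that no prime `l` divides them all (`exists_not_dvd_sum`). In characteristic
`l`, take `w = (1, …, 1)`; in another positive characteristic `p`, use `p * X i`. In characteristic
zero, a bad `l` would give an integral `w ≡ 1` mod `l` satisfying every integral relation, yet `P(w)
≡ 1` mod `l` forces one to fail. Part (2) uses the norm form of `ℤ[X] / (f)`, with `f` irreducible
modulo a prime `q`, at the coefficient vector of `f / (X - θ)`. All conjugate linear factors but one
vanish there, and a primitive relation would make `q` divide `1`. -/

theorem map_taylorExpansionAt {σ R K L : Type*} [CommRing R] [CommRing K] [CommRing L]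
    [Algebra R K] [Algebra R L] (f : K →ₐ[R] L) (P : MvPolynomial σ R) (α : σ → K) :
    MvPolynomial.map (f : K →+* L) (taylorExpansionAt P α) =
      taylorExpansionAt P (fun i => f (α i)) := by
  unfold taylorExpansionAt
  induction P using MvPolynomial.induction_on with
  | C a =>
    simp [MvPolynomial.algebraMap_apply]
  | add p q hp hq => simp [hp, hq]
  | mul_X p i hp => simp [hp]

theorem VanishesToOrder.map {σ R K L : Type*} [CommRing R] [CommRing K] [CommRing L]
    [Algebra R K] [Algebra R L] (f : K →ₐ[R] L) {P : MvPolynomial σ R} {α : σ → K} {v : ℕ}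
    (h : VanishesToOrder P α v) : VanishesToOrder P (fun i => f (α i)) v := by
  intro m hm
  rw [← map_taylorExpansionAt, coeff_map, h m hm, map_zero]

theorem VanishesToOrder.of_map {σ R K L : Type*} [CommRing R] [CommRing K] [CommRing L]
    [Algebra R K] [Algebra R L] {f : K →ₐ[R] L} (hf : Function.Injective f)
    {P : MvPolynomial σ R} {α : σ → K} {v : ℕ}
    (h : VanishesToOrder P (fun i => f (α i)) v) : VanishesToOrder P α v := by
  intro m hm
  have := h m hm
  rw [← map_taylorExpansionAt, coeff_map] at this
  exact hf (by simpa using this)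

/-! ### Vanishing on the span of points of high multiplicity. -/

/-- Substituting forms of degree one into a polynomial without terms of degree less than `v`
creates no terms of degree less than `v`. -/
theorem coeff_aeval_of_isHomogeneous_one {σ τ K : Type*} [CommRing K] {G : MvPolynomial σ K}
    {v : ℕ} (hG : ∀ a : σ →₀ ℕ, a.degree < v → coeff a G = 0) {L : σ → MvPolynomial τ K}
    (hL : ∀ i, (L i).IsHomogeneous 1) {m : τ →₀ ℕ} (hm : m.degree < v) :
    coeff m (aeval L G) = 0 := by
  classical
  rw [G.as_sum, map_sum, coeff_sum]
  refine Finset.sum_eq_zero fun a ha => ?_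
  have hav : v ≤ a.degree := by
    by_contra! h
    exact (mem_support_iff.1 ha) (hG a h)
  have hhom : (aeval L (monomial a (coeff a G))).IsHomogeneous (1 * a.degree) :=
    (isHomogeneous_monomial _ rfl).aeval L hL
  exact hhom.coeff_eq_zero (by omega)

/-- Dehomogenizing a form loses nothing: the total degree determines the erased exponent, so
distinct monomials stay distinct. -/
theorem coeff_erase_aeval_update_one {ι K : Type*} [DecidableEq ι] [CommRing K]
    {S : MvPolynomial ι K} {d : ℕ} (hS : S.IsHomogeneous d) (i : ι) {m : ι →₀ ℕ}
    (hm : m.degree = d) :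
    coeff (m.erase i) (aeval (Function.update (X : ι → MvPolynomial ι K) i 1) S) = coeff m S := by
  classical
  have key : ∀ (a : ι →₀ ℕ) (c : K),
      aeval (Function.update (X : ι → MvPolynomial ι K) i 1) (monomial a c) =
        monomial (a.erase i) c := by
    intro a c
    rw [aeval_monomial, ← Finsupp.mul_prod_erase' a i _ (by simp), monomial_eq]
    simp only [Function.update_self, one_pow, one_mul, algebraMap_eq]
    congr 1
    refine Finsupp.prod_congr fun j hj => ?_
    rw [Function.update_of_ne]
    rintro rfl
    simp at hj
  have hdeg : ∀ a : ι →₀ ℕ, a.degree = a i + (a.erase i).degree := by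
    intro a
    conv_lhs => rw [← Finsupp.single_add_erase i a, map_add]
    simp
  conv_lhs => rw [S.as_sum, map_sum, coeff_sum]
  simp only [key, coeff_monomial]
  rw [Finset.sum_eq_single m]
  · simp
  · intro a ha hne
    rw [if_neg]
    intro h
    apply hne
    have h1 : a.degree = d := by
      by_contra h'
      exact (mem_support_iff.1 ha) (hS.coeff_eq_zero h')
    have h2 := hdeg a
    have h3 := hdeg m
    rw [← Finsupp.single_add_erase i a, ← Finsupp.single_add_erase i m, h]
    congr 2
    rw [h] at h2
    omega
  · intro h
    simp [notMem_support_iff.1 h]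

/-- A form of degree `d` that vanishes to order `v` at at most `n` points, where
`(n - 1) * d < n * v`, vanishes on the span of these points. -/
theorem aeval_sum_smul_eq_zero {σ ι R K : Type*} [Fintype ι] [Nonempty ι] [CommRing R] [CommRing K]
    [Algebra R K] {P : MvPolynomial σ R} {d v n : ℕ} (hP : P.IsHomogeneous d)
    (hn : Fintype.card ι ≤ n) (hv : n * d < n * v + d) {β : ι → σ → K}
    (hβ : ∀ i, VanishesToOrder P (β i) v) (t : ι → K) :
    aeval (∑ i, t i • β i) P = 0 := by
  classical
  set L : σ → MvPolynomial ι K := fun l => ∑ j, C (β j l) * X j with hL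
  have hLhom : ∀ s : Finset ι, ∀ l, (∑ j ∈ s, C (β j l) * X j : MvPolynomial ι K).IsHomogeneous 1 :=
    fun s l => IsHomogeneous.sum _ _ _ fun j _ => by
      simpa using (isHomogeneous_C ι (β j l)).mul (isHomogeneous_X K j)
  have hS : (aeval L P).IsHomogeneous d := by
    simpa using hP.aeval L (fun l => hLhom _ l)
  have hcoeff : ∀ m : ι →₀ ℕ, coeff m (aeval L P) = 0 := by
    intro m
    by_cases hm : m.degree = d
    swap
    · exact hS.coeff_eq_zero hm
    -- Otherwise every exponent is at most `d - v`, and summing gives `d ≤ n * (d - v)`, against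
    -- `hv`.
    obtain ⟨i, hi⟩ : ∃ i, d < v + m i := by
      by_contra! h
      have h1 : Fintype.card ι * v + d ≤ Fintype.card ι * d := by
        have := Finset.sum_le_sum fun i (_ : i ∈ Finset.univ) => h i
        rw [Finset.sum_add_distrib, ← Finsupp.degree_eq_sum, hm] at this
        simpa using this
      obtain ⟨i⟩ := ‹Nonempty ι›
      have h2 : v ≤ d := le_trans (Nat.le_add_right _ _) (h i)
      obtain ⟨e, rfl⟩ := Nat.exists_eq_add_of_le hn
      have h3 : e * v ≤ e * d := Nat.mul_le_mul_left _ h2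
      nlinarith
    rw [← coeff_erase_aeval_update_one hS i hm]
    -- At `t i = 1` the restriction is the expansion of `P` at `β i` with linear forms in the other
    -- variables put for `z`. The degree of `m.erase i` is `d - m i < v`.
    have heq : aeval (Function.update (X : ι → MvPolynomial ι K) i 1) (aeval L P) =
        aeval (fun l => ∑ j ∈ Finset.univ.erase i, C (β j l) * X j)
          (taylorExpansionAt P (β i)) := by
      unfold taylorExpansionAt
      have h1 := congrArg (fun g => g P) (comp_aeval (R := R) L
        ((aeval (Function.update (X : ι → MvPolynomial ι K) i 1)).restrictScalars R))
      have h2 := congrArg (fun g => g P) (comp_aeval (R := R)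
        (fun l => C (β i l) + X l : σ → MvPolynomial σ K)
        ((aeval (fun l => ∑ j ∈ Finset.univ.erase i, C (β j l) * X j :
          σ → MvPolynomial ι K)).restrictScalars R))
      simp only [AlgHom.coe_comp, Function.comp_apply,
        AlgHom.restrictScalars_apply] at h1 h2
      rw [h1, h2]
      congr 2
      funext l
      rw [hL]
      simp only [map_sum, map_mul, map_add, aeval_X, ← algebraMap_eq, AlgHom.commutes]
      rw [← Finset.add_sum_erase _ _ (Finset.mem_univ i)]
      congr 1
      · simp
      · refine Finset.sum_congr rfl fun j hj => ?_
        rw [Function.update_of_ne (Finset.ne_of_mem_erase hj)]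
    rw [heq]
    refine coeff_aeval_of_isHomogeneous_one (v := v) (hβ i) (fun l => hLhom _ l) ?_
    have : m.degree = m i + (m.erase i).degree := by
      conv_lhs => rw [← Finsupp.single_add_erase i m, map_add]
      simp
    omega
  have hzero : aeval L P = 0 := MvPolynomial.ext _ _ (by simpa using hcoeff)
  have h1 := congrArg (fun g => g P) (comp_aeval (R := R) L ((aeval t).restrictScalars R))
  simp only [AlgHom.coe_comp, Function.comp_apply,
        AlgHom.restrictScalars_apply, hzero, map_zero] at h1
  rw [h1]
  congr 2
  funext l
  simp [hL, Finset.sum_apply, mul_comm]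

/-! ### Specialization and Galois descent of linear relations. -/

/-- A nonzero element of a finitely generated domain over a field `k` is not killed by every
specialization to an algebraically closed extension of `k`. -/
theorem exists_algHom_apply_ne_zero {k A Ω : Type*} [Field k] [CommRing A] [IsDomain A]
    [Algebra k A] [Algebra.FiniteType k A] [Field Ω] [Algebra k Ω] [IsAlgClosed Ω] {a : A}
    (ha : a ≠ 0) : ∃ ψ : A →ₐ[k] Ω, ψ a ≠ 0 := by
  -- By the Nullstellensatz some maximal ideal misses `a`, and its residue field is finite over `k`,
  -- hence embeds in `Ω`.
  have hJ : IsJacobsonRing A := isJacobsonRing_of_finiteType (A := k)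
  have h0 : Ideal.jacobson (⊥ : Ideal A) = ⊥ :=
    hJ.out ((Ideal.isRadical_iff_quotient_reduced _).2 inferInstance)
  have h1 : a ∉ Ideal.jacobson (⊥ : Ideal A) := by rwa [h0]
  rw [Ideal.jacobson, Submodule.mem_sInf] at h1
  push Not at h1
  obtain ⟨I, ⟨-, hI⟩, haI⟩ := h1
  let : Field (A ⧸ I) := Ideal.Quotient.field I
  have : Module.Finite k (A ⧸ I) := finite_of_finite_type_of_isJacobsonRing k (A ⧸ I)
  refine ⟨(IsAlgClosed.lift : (A ⧸ I) →ₐ[k] Ω).comp (Ideal.Quotient.mkₐ k I), fun h => haI ?_⟩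
  rw [AlgHom.comp_apply, map_eq_zero] at h
  exact Ideal.Quotient.eq_zero_iff_mem.1 h

/-- Galois descent for linear relations over a finite separable extension `E`: averaging with the
trace. -/
theorem exists_descent_of_finite {k E Ω ι : Type*} [Fintype ι] [Field k] [Field E] [Field Ω]
    [Algebra k E] [Algebra k Ω] [FiniteDimensional k E] [Algebra.IsSeparable k E] [IsAlgClosed Ω]
    (b : ι → E) (w : ι → k) (hw : ∑ i, w i • b i ≠ 0) :
    ∃ c : ι → k, ∑ i, c i * w i = 1 ∧ ∀ u : ι → Ω,
      (∀ τ : E →ₐ[k] Ω, ∑ i, τ (b i) * u i = 0) → ∑ i, algebraMap k Ω (c i) * u i = 0 := by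
  obtain ⟨x, hx⟩ := Algebra.trace_surjective k E 1
  set D := ∑ i, w i • b i with hD
  refine ⟨fun i => Algebra.trace k E (x * D⁻¹ * b i), ?_, fun u hu => ?_⟩
  · calc _ = ∑ i, Algebra.trace k E (x * D⁻¹ * (w i • b i)) := by
          refine Finset.sum_congr rfl fun i _ => ?_
          rw [mul_smul_comm, map_smul, smul_eq_mul, mul_comm]
      _ = Algebra.trace k E (x * D⁻¹ * D) := by
          rw [← map_sum, ← Finset.mul_sum]
      _ = 1 := by rw [inv_mul_cancel_right₀ hw, hx]
  · simp only [trace_eq_sum_embeddings (K := k) (L := E) Ω, Finset.sum_mul]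
    rw [Finset.sum_comm]
    refine Finset.sum_eq_zero fun τ _ => ?_
    simp only [map_mul, mul_assoc, ← Finset.mul_sum]
    rw [hu τ, mul_zero, mul_zero]

/-- Galois descent for linear relations. -/
theorem exists_descent {k Ω ι : Type*} [Fintype ι] [Field k] [Field Ω] [Algebra k Ω]
    [IsGalois k Ω] [IsAlgClosed Ω] (b : ι → Ω) (w : ι → k) (hw : ∑ i, w i • b i ≠ 0) :
    ∃ c : ι → k, ∑ i, c i * w i = 1 ∧ ∀ u : ι → Ω,
      (∀ T : Ω ≃ₐ[k] Ω, ∑ i, b i * T (u i) = 0) → ∑ i, algebraMap k Ω (c i) * u i = 0 := by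
  let E := IntermediateField.adjoin k (Set.range b)
  have : FiniteDimensional k E :=
    IntermediateField.finiteDimensional_adjoin fun x _ => Algebra.IsIntegral.isIntegral x
  let b' : ι → E := fun i => ⟨b i, IntermediateField.subset_adjoin k _ ⟨i, rfl⟩⟩
  have hval : E.val (∑ i, w i • b' i) = ∑ i, w i • b i := by
    rw [map_sum]
    rfl
  obtain ⟨c, hc, h⟩ := exists_descent_of_finite (Ω := Ω) b' w fun h => hw (by
    rw [← hval, h, map_zero])
  refine ⟨c, hc, fun u hu => h u fun τ => ?_⟩
  -- Every embedding of `E` extends to an automorphism of `Ω`; applying it to the hypothesis at its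
  -- inverse moves the conjugation from `u` to `b`.
  let T : Ω →ₐ[k] Ω := τ.liftNormal Ω
  let T' : Ω ≃ₐ[k] Ω := AlgEquiv.ofBijective T (Algebra.IsAlgebraic.algHom_bijective T)
  have h0 := congrArg T' (hu T'.symm)
  rw [map_sum, map_zero] at h0
  rw [← h0]
  refine Finset.sum_congr rfl fun i _ => ?_
  rw [map_mul, AlgEquiv.apply_symm_apply]
  congr 1
  exact (τ.liftNormal_commutes Ω (b' i)).symm

/-- If `w` is not in the span of the specializations of `α` to the algebraic closure of `k`, then
some linear relation of `α` over `k` does not hold for `w`. -/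
theorem exists_relation_of_notMem_span {k A : Type*} [Field k] [PerfectField k] [CommRing A]
    [IsDomain A] [Algebra k A] [Algebra.FiniteType k A] {n : ℕ} (α : Fin n → A) (w : Fin n → k)
    (hw : (fun i => algebraMap k (AlgebraicClosure k) (w i)) ∉
      Submodule.span (AlgebraicClosure k)
        (Set.range fun (ψ : A →ₐ[k] AlgebraicClosure k) (i : Fin n) => ψ (α i))) :
    ∃ c : Fin n → k, ∑ i, c i • α i = 0 ∧ ∑ i, c i * w i = 1 := by
  classical
  obtain ⟨g, hgw, hg⟩ := Submodule.exists_le_ker_of_notMem hw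
  have hgb : ∀ u : Fin n → AlgebraicClosure k, g u = ∑ i, g (Pi.single i 1) * u i := by
    intro u
    conv_lhs => rw [pi_eq_sum_univ' u, map_sum]
    refine Finset.sum_congr rfl fun i _ => ?_
    rw [map_smul, smul_eq_mul, mul_comm]
  obtain ⟨c, hc, h⟩ := exists_descent (fun i => g (Pi.single i 1)) w (by
    rw [hgb] at hgw
    simpa only [Algebra.smul_def, mul_comm] using hgw)
  refine ⟨c, ?_, hc⟩
  by_contra hne
  obtain ⟨ψ, hψ⟩ := exists_algHom_apply_ne_zero (k := k) (Ω := AlgebraicClosure k) hne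
  apply hψ
  rw [map_sum]
  simp only [Algebra.smul_def, map_mul, AlgHom.commutes]
  -- A conjugate of a specialization is again a specialization, so `g` kills it too.
  refine h (fun i => ψ (α i)) fun T => ?_
  rw [← hgb (fun i => T (ψ (α i)))]
  exact hg (Submodule.subset_span ⟨(T : _ →ₐ[k] _).comp ψ, rfl⟩)

/-- If a form over `ℤ` vanishes to high order at `α` but not at `w`, then some linear relation of
`α` over the perfect field `k` does not hold for `w`. -/
theorem exists_relation_of_vanishesToOrder {k K : Type*} [Field k] [PerfectField k] [Field K]
    [Algebra k K] {n d v : ℕ} {α : Fin n → K} {P : MvPolynomial (Fin n) ℤ}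
    (hP : P.IsHomogeneous d) (hv : n * d < n * v + d) (hα : VanishesToOrder P α v)
    {w : Fin n → k} (hw0 : w ≠ 0) (hw : aeval w P ≠ 0) :
    ∃ c : Fin n → k, ∑ i, c i • α i = 0 ∧ ∑ i, c i * w i = 1 := by
  classical
  let A := Algebra.adjoin k (Set.range α)
  have hA : Algebra.FiniteType k A := A.fg_iff_finiteType.1 ⟨Finset.univ.image α, by simp [A]⟩
  let α' : Fin n → A := fun i => ⟨α i, Algebra.subset_adjoin ⟨i, rfl⟩⟩
  suffices hα' : ∃ c : Fin n → k, ∑ i, c i • α' i = 0 ∧ ∑ i, c i * w i = 1 by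
    obtain ⟨c, hc, h⟩ := hα'
    refine ⟨c, ?_, h⟩
    have := congrArg A.val hc
    rw [map_sum, map_zero] at this
    exact this
  apply exists_relation_of_notMem_span
  intro hmem
  set Ω := AlgebraicClosure k
  obtain ⟨s, hs, hspan, hli⟩ := exists_linearIndependent Ω
    (Set.range fun (ψ : A →ₐ[k] Ω) (i : Fin n) => ψ (α' i))
  rw [← hspan] at hmem
  have : Fintype s := hli.setFinite.fintype
  have hcard : Fintype.card s ≤ n := by simpa using hli.fintype_card_le_finrank
  have hne : Nonempty s := by
    by_contra h
    rw [not_nonempty_iff, Set.isEmpty_coe_sort] at h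
    rw [h, Submodule.span_empty, Submodule.mem_bot] at hmem
    exact hw0 (funext fun i => by simpa using congrFun hmem i)
  rw [← Subtype.range_coe (s := s), Submodule.mem_span_range_iff_exists_fun] at hmem
  obtain ⟨t, ht⟩ := hmem
  have hvan : ∀ i : s, VanishesToOrder P (i : Fin n → Ω) v := by
    rintro ⟨_, hi⟩
    obtain ⟨ψ, rfl⟩ := hs hi
    have h1 : VanishesToOrder P α' v :=
      VanishesToOrder.of_map (f := A.val.restrictScalars ℤ) Subtype.val_injective hα
    exact h1.map (ψ.restrictScalars ℤ)
  have h0 := aeval_sum_smul_eq_zero hP hcard hv hvan t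
  rw [ht] at h0
  exact hw ((map_eq_zero (algebraMap k Ω)).1 ((aeval_algebraMap_apply Ω w P).symm.trans h0))

/-! ### Integral relations, one prime at a time. -/

theorem aeval_intCast {σ R : Type*} [CommRing R] (w : σ → ℤ) (P : MvPolynomial σ ℤ) :
    aeval (fun i => (w i : R)) P = ((eval w P : ℤ) : R) :=
  aeval_algebraMap_apply R w P

theorem hasPrimitiveLinearRelation_iff {n : ℕ} {K : Type*} [CommRing K] (α : Fin n → K) :
    HasPrimitiveLinearRelation α ↔ ∃ q : Fin n → ℤ, ∑ i, q i • α i = 0 ∧ ∑ i, q i = 1 := by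
  constructor
  · rintro ⟨Q, hQ, h0, h1⟩
    have hsum : Q = ∑ i, C (coeff (Finsupp.single i 1) Q) * X i := by
      refine MvPolynomial.ext _ _ fun m => ?_
      by_cases hm : m.degree = 1
      · obtain ⟨j, hj⟩ : ∃ j, m j ≠ 0 := by
          by_contra! h
          rw [show m = 0 from Finsupp.ext h, map_zero] at hm
          exact zero_ne_one hm
        obtain ⟨r, rfl⟩ := exists_add_of_le
          (Finsupp.single_le_iff.2 (Nat.one_le_iff_ne_zero.2 hj) : Finsupp.single j 1 ≤ m)
        have hr : r = 0 := by
          rw [← Finsupp.degree_eq_zero_iff]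
          simpa using hm
        subst hr
        rw [add_zero]
        rw [coeff_sum, Finset.sum_eq_single j]
        · rw [coeff_C_mul, coeff_X, if_pos rfl, mul_one]
        · intro i _ hij
          rw [coeff_C_mul, coeff_X, if_neg, mul_zero]
          rw [Finsupp.single_left_inj one_ne_zero]
          exact hij
        · simp
      · rw [hQ.coeff_eq_zero hm]
        refine (IsHomogeneous.coeff_eq_zero (n := 1) ?_ hm).symm
        exact IsHomogeneous.sum _ _ _ fun i _ => by
          simpa using (isHomogeneous_C (Fin n) _).mul (isHomogeneous_X ℤ i)
    refine ⟨fun i => coeff (Finsupp.single i 1) Q, ?_, ?_⟩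
    · rw [hsum] at h0
      simpa using h0
    · rw [hsum] at h1
      simpa using h1
  · rintro ⟨q, h0, h1⟩
    refine ⟨∑ i, C (q i) * X i, ?_, by simpa using h0, by simpa using h1⟩
    exact IsHomogeneous.sum _ _ _ fun i _ => by
      simpa using (isHomogeneous_C (Fin n) (q i)).mul (isHomogeneous_X ℤ i)

/-- In characteristic zero, a linear functional modulo `l` on the `ℤ`-span of `α` lifts to `ℤ`. -/
theorem exists_lift_of_dvd {n : ℕ} {K : Type*} [Field K] [CharZero K] (α : Fin n → K) (l : ℕ)
    (h : ∀ q : Fin n → ℤ, ∑ i, q i • α i = 0 → (l : ℤ) ∣ ∑ i, q i) :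
    ∃ w : Fin n → ℤ, (∀ i, (w i : ZMod l) = 1) ∧
      ∀ q : Fin n → ℤ, ∑ i, q i • α i = 0 → ∑ i, q i * w i = 0 := by
  classical
  let f : (Fin n → ℤ) →ₗ[ℤ] K := Fintype.linearCombination ℤ α
  let s : (Fin n → ℤ) →ₗ[ℤ] ZMod l := Fintype.linearCombination ℤ (fun _ => (1 : ZMod l))
  have hfs : LinearMap.ker f ≤ LinearMap.ker s := by
    intro q hq
    rw [LinearMap.mem_ker, Fintype.linearCombination_apply] at hq ⊢
    have := (ZMod.intCast_zmod_eq_zero_iff_dvd _ l).2 (h q hq)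
    simpa using this
  -- The `ℤ`-span of `α` is finitely generated and torsion-free, so it is free and the functional
  -- lifts.
  have : Module.Free ℤ (LinearMap.range f) := Module.free_of_finite_type_torsion_free'
  let e := f.quotKerEquivRange
  obtain ⟨g, hg⟩ := Module.projective_lifting_property
    (Algebra.linearMap ℤ (ZMod l)) (((LinearMap.ker f).liftQ s hfs).comp e.symm.toLinearMap)
    ZMod.intCast_surjective
  have hg' : ∀ q, ((g (f.rangeRestrict q) : ℤ) : ZMod l) = s q := by
    intro q
    have h1 := LinearMap.congr_fun hg (f.rangeRestrict q)
    have h2 : e.symm (f.rangeRestrict q) = (LinearMap.ker f).mkQ q := by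
      rw [LinearEquiv.symm_apply_eq]
      rfl
    simpa [h2] using h1
  refine ⟨fun i => g (f.rangeRestrict (Pi.single i 1)), fun i => ?_, fun q hq => ?_⟩
  · rw [hg']
    simp [s, Fintype.linearCombination_apply_single]
  · have h1 : g (f.rangeRestrict q) = 0 := by
      have : f.rangeRestrict q = 0 := Subtype.ext (by
        simpa [f, Fintype.linearCombination_apply] using hq)
      rw [this, map_zero]
    rw [← h1, pi_eq_sum_univ' q, map_sum, map_sum]
    refine Finset.sum_congr rfl fun i _ => ?_
    rw [map_smul, map_smul, smul_eq_mul, ← pi_eq_sum_univ' q]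

/-- The sums of the coefficients of the integral relations of `α` have no common prime factor. -/
theorem exists_not_dvd_sum {n d v : ℕ} {K : Type*} [Field K] (hn : 1 ≤ n)
    {α : Fin n → K} {P : MvPolynomial (Fin n) ℤ} (hP : P.IsHomogeneous d)
    (hv : n * d < n * v + d) (hα : VanishesToOrder P α v) (hP1 : eval (fun _ => 1) P = 1)
    (l : ℕ) [Fact l.Prime] : ∃ q : Fin n → ℤ, ∑ i, q i • α i = 0 ∧ ¬ (l : ℤ) ∣ ∑ i, q i := by
  have i0 : Fin n := ⟨0, hn⟩
  have hPl : ∀ w : Fin n → ℤ, (∀ i, (w i : ZMod l) = 1) →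
      aeval (fun i => (w i : ZMod l)) P = 1 := by
    intro w hw
    have h := aeval_intCast (R := ZMod l) (fun _ => 1) P
    rw [hP1] at h
    simpa only [hw, Int.cast_one] using h
  obtain ⟨p, hp⟩ := CharP.exists K
  obtain hprime | rfl := CharP.char_is_prime_or_zero K p
  · have : Fact p.Prime := ⟨hprime⟩
    by_cases hpl : l = p
    · subst hpl
      let : Algebra (ZMod l) K := ZMod.algebra K l
      obtain ⟨c, hc, hc1⟩ := exists_relation_of_vanishesToOrder (k := ZMod l) (w := fun _ => 1)
        hP hv hα (fun h => one_ne_zero (congrFun h i0)) (by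
          have h := hPl (fun _ => 1) (by simp)
          simp only [Int.cast_one] at h
          rw [h]
          exact one_ne_zero)
      refine ⟨fun i => (c i).val, ?_, ?_⟩
      · rw [← hc]
        refine Finset.sum_congr rfl fun i _ => ?_
        rw [Algebra.smul_def (c i), show algebraMap (ZMod l) K (c i) = ((c i).val : K) by
          conv_lhs => rw [← ZMod.natCast_zmod_val (c i), map_natCast]]
        simp
      · rw [← ZMod.intCast_zmod_eq_zero_iff_dvd]
        simp only [mul_one] at hc1
        simp [hc1]
    · refine ⟨Pi.single i0 p, ?_, ?_⟩
      · rw [Finset.sum_eq_single i0] <;> simp +contextual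
      · rw [Finset.sum_pi_single']
        simp only [Finset.mem_univ, if_true]
        rw [Int.natCast_dvd_natCast, Nat.prime_dvd_prime_iff_eq Fact.out hprime]
        exact hpl
  · have : CharZero K := CharP.charP_to_charZero K
    by_contra! h
    obtain ⟨w, hw1, hw⟩ := exists_lift_of_dvd α l h
    have hw0 : eval w P ≠ 0 := by
      intro h0
      have h1 := hPl w hw1
      rw [aeval_intCast, h0] at h1
      simp at h1
    obtain ⟨c, hc, hc1⟩ := exists_relation_of_vanishesToOrder (k := ℚ) (w := fun i => (w i : ℚ))
        hP hv hα (fun h => by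
          have h1 : w i0 = 0 := by simpa using congrFun h i0
          have := hw1 i0
          simp [h1] at this) (by
          rw [aeval_intCast]
          exact_mod_cast hw0)
    obtain ⟨N, hN⟩ := IsLocalization.exist_integer_multiples_of_finite (nonZeroDivisors ℤ) c
    choose q hq using hN
    have hN0 : ((N : ℤ) : ℚ) ≠ 0 := by simp
    have hq' : ∀ i, (q i : ℚ) = (N : ℤ) * c i := fun i => by
      have := hq i
      simpa [Algebra.smul_def] using this
    have h1 : ∑ i, q i • α i = 0 := by
      have : ∑ i, q i • α i = ((N : ℤ) : ℚ) • ∑ i, c i • α i := by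
        rw [Finset.smul_sum]
        refine Finset.sum_congr rfl fun i _ => ?_
        rw [smul_smul, ← hq', Int.cast_smul_eq_zsmul]
      rw [this, hc, smul_zero]
    have h2 := congrArg (Int.cast : ℤ → ℚ) (hw q h1)
    push_cast at h2
    simp only [hq', mul_assoc, ← Finset.mul_sum, hc1] at h2
    simp at h2

/-- A primitive form that vanishes at `α` to high order forces a primitive linear relation. -/
theorem hasPrimitiveLinearRelation_of_vanishesToOrder {n d v : ℕ} {K : Type*} [Field K]
    (hn : 1 ≤ n) {α : Fin n → K} {P : MvPolynomial (Fin n) ℤ} (hP : P.IsHomogeneous d)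
    (hv : n * d < n * v + d) (hα : VanishesToOrder P α v) (hP1 : eval (fun _ => 1) P = 1) :
    HasPrimitiveLinearRelation α := by
  rw [hasPrimitiveLinearRelation_iff]
  let I : Ideal ℤ := (LinearMap.ker (Fintype.linearCombination ℤ α)).map
    (Fintype.linearCombination ℤ (fun _ : Fin n => (1 : ℤ)))
  have hI : ∀ x, x ∈ I ↔ ∃ q : Fin n → ℤ, ∑ i, q i • α i = 0 ∧ ∑ i, q i = x := by
    intro x
    simp [I, Submodule.mem_map, Fintype.linearCombination_apply]
  rw [← hI]
  have hgen : Submodule.IsPrincipal.generator I ∈ I := Submodule.IsPrincipal.generator_mem I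
  set g := Submodule.IsPrincipal.generator I with hg
  have h1 : g.natAbs = 1 := by
    by_contra h
    obtain ⟨l, hl, hlg⟩ := Nat.exists_prime_and_dvd h
    have : Fact l.Prime := ⟨hl⟩
    obtain ⟨q, hq, hql⟩ := exists_not_dvd_sum hn hP hv hα hP1 l
    apply hql
    have h2 : g ∣ ∑ i, q i :=
      (Submodule.IsPrincipal.mem_iff_generator_dvd I).1 ((hI _).2 ⟨q, hq, rfl⟩)
    exact (Int.natCast_dvd.2 hlg).trans h2
  have h2 : IsUnit g := Int.isUnit_iff_natAbs_eq.2 h1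
  exact (Submodule.IsPrincipal.mem_iff_generator_dvd I).2 h2.dvd

/-! ### Sharpness: a generic root and its norm form. -/

theorem exists_monic_irreducible_map_zmod (q k : ℕ) [Fact q.Prime] (hk : 1 ≤ k) :
    ∃ f : Polynomial ℤ, f.Monic ∧ f.natDegree = k ∧
      Irreducible (f.map (Int.castRingHom (ZMod q))) := by
  let pb := Field.powerBasisOfFiniteOfSeparable (ZMod q) (GaloisField q k)
  have hint : IsIntegral (ZMod q) pb.gen := pb.isIntegral_gen
  have hdeg : (minpoly (ZMod q) pb.gen).natDegree = k := by
    rw [pb.natDegree_minpoly, ← pb.finrank, GaloisField.finrank q (by omega)]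
  obtain ⟨f, hf, hfd, hfm⟩ := Polynomial.lifts_and_natDegree_eq_and_monic
    (f := Int.castRingHom (ZMod q)) (p := minpoly (ZMod q) pb.gen)
    ((Polynomial.mem_lifts _).2 (Polynomial.map_surjective _ ZMod.intCast_surjective _))
    (minpoly.monic hint)
  exact ⟨f, hfm, hfd.trans hdeg, by rw [hf]; exact minpoly.irreducible hint⟩

theorem map_eq_zero_of_aeval_eq_zero {k₀ K : Type*} [Field k₀] [Field K] [Algebra k₀ K]
    {f u : Polynomial ℤ} {θ : K} (hfm : f.Monic) (hfi : Irreducible (f.map (algebraMap ℤ k₀)))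
    (hθ : Polynomial.aeval θ f = 0) (hdeg : u.degree < f.degree)
    (hu : Polynomial.aeval θ u = 0) : u.map (algebraMap ℤ k₀) = 0 := by
  have hmin : f.map (algebraMap ℤ k₀) = minpoly k₀ θ :=
    minpoly.eq_of_irreducible_of_monic hfi (by rwa [Polynomial.aeval_map_algebraMap])
      (hfm.map _)
  have hdvd : f.map (algebraMap ℤ k₀) ∣ u.map (algebraMap ℤ k₀) := by
    rw [hmin]
    exact minpoly.dvd k₀ θ (by rwa [Polynomial.aeval_map_algebraMap])
  refine Polynomial.eq_zero_of_dvd_of_degree_lt hdvd ?_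
  rw [hfm.degree_map]
  exact Polynomial.degree_map_le.trans_lt hdeg

/-- Over any algebraically closed field `K` there is, for a suitable prime `q`, a root `θ` of a
monic integral polynomial of degree `k` that is linearly generic: integral relations of degree less
than `k` for `θ` are trivial modulo `q`. -/
theorem exists_generic_root (K : Type*) [Field K] [IsAlgClosed K] (k : ℕ) (hk : 1 ≤ k) :
    ∃ q : ℕ, q.Prime ∧ ∃ (f : Polynomial ℤ) (θ : K), f.Monic ∧ f.natDegree = k ∧
      Polynomial.aeval θ f = 0 ∧ Polynomial.aeval θ f.derivative ≠ 0 ∧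
      ∀ u : Polynomial ℤ, u.degree < k → Polynomial.aeval θ u = 0 →
        ∀ n, (q : ℤ) ∣ u.coeff n := by
  obtain ⟨p, hp⟩ := CharP.exists K
  obtain ⟨q, hq, hqp⟩ : ∃ q : ℕ, q.Prime ∧ (q = p ∨ p = 0) := by
    obtain h | h := CharP.char_is_prime_or_zero K p
    · exact ⟨p, h, Or.inl rfl⟩
    -- In characteristic zero any prime would serve.
    · exact ⟨2, Nat.prime_two, Or.inr h⟩
  have : Fact q.Prime := ⟨hq⟩
  obtain ⟨f, hfm, hfd, hfi⟩ := exists_monic_irreducible_map_zmod q k hk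
  have hfdeg : f.degree = k := by rw [Polynomial.degree_eq_natDegree hfm.ne_zero, hfd]
  obtain ⟨θ, hθ'⟩ := IsAlgClosed.exists_root (f.map (algebraMap ℤ K)) (by
    rw [hfm.degree_map, hfdeg]
    exact_mod_cast (by omega : k ≠ 0))
  have hθ : Polynomial.aeval θ f = 0 := by
    rwa [Polynomial.IsRoot, Polynomial.eval_map_algebraMap] at hθ'
  have key : ∀ u : Polynomial ℤ, u.degree < k → Polynomial.aeval θ u = 0 →
      u.map (Int.castRingHom (ZMod q)) = 0 := by
    intro u hdeg hu
    rw [← hfdeg] at hdeg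
    obtain rfl | rfl := hqp
    · let : Algebra (ZMod q) K := ZMod.algebra K q
      exact map_eq_zero_of_aeval_eq_zero (k₀ := ZMod q) hfm hfi hθ hdeg hu
    · have : CharZero K := CharP.charP_to_charZero K
      have hirr : Irreducible f := hfm.irreducible_of_irreducible_map _ _ hfi
      have h := map_eq_zero_of_aeval_eq_zero (k₀ := ℚ) hfm
        (hfm.irreducible_iff_irreducible_map_fraction_map.1 hirr) hθ hdeg hu
      rw [Polynomial.map_eq_zero_iff (algebraMap ℤ ℚ).injective_int] at h
      rw [h, Polynomial.map_zero]
  refine ⟨q, hq, f, θ, hfm, hfd, hθ, fun h => ?_, fun u hdeg hu n => ?_⟩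
  · have h1 := key f.derivative
      (by rw [← hfdeg]; exact Polynomial.degree_derivative_lt hfm.ne_zero) h
    rw [← Polynomial.derivative_map] at h1
    have hsep : (f.map (Int.castRingHom (ZMod q))).Separable :=
      PerfectField.separable_of_irreducible hfi
    exact (Polynomial.separable_iff_derivative_ne_zero hfi).1 hsep h1
  · have h1 := congrArg (fun g => Polynomial.coeff g n) (key u hdeg hu)
    simpa [ZMod.intCast_zmod_eq_zero_iff_dvd] using h1

/-- Evaluated at a root `θ` of a monic `f`, this sum is the coefficient of `X ^ j` in `f / (X - θ)`.
-/
theorem coeff_sum_divided {f : Polynomial ℤ} (j n : ℕ) :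
    (∑ i ∈ Finset.Icc (j + 1) f.natDegree, Polynomial.C (f.coeff i) *
      Polynomial.X ^ (i - (j + 1)) : Polynomial ℤ).coeff n = f.coeff (n + j + 1) := by
  rw [Polynomial.finsetSum_coeff]
  simp only [Polynomial.coeff_C_mul_X_pow]
  by_cases h : n + j + 1 ≤ f.natDegree
  · rw [Finset.sum_eq_single (n + j + 1)]
    · rw [if_pos (by omega)]
    · intro i hi hne
      rw [Finset.mem_Icc] at hi
      rw [if_neg (by omega)]
    · intro h'
      rw [Finset.mem_Icc] at h'
      omega
  · rw [Polynomial.coeff_eq_zero_of_natDegree_lt (by omega)]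
    refine Finset.sum_eq_zero fun i hi => ?_
    rw [Finset.mem_Icc] at hi
    rw [if_neg (by omega)]

/-- The coefficients of `f / (X - θ)` have no integral relation that is nontrivial modulo `q`. -/
theorem dvd_of_sum_coeff_divByMonic_eq_zero {K : Type*} [Field K] {k q : ℕ} {f : Polynomial ℤ}
    {θ : K} (hfm : f.Monic) (hfd : f.natDegree = k)
    (h : ∀ u : Polynomial ℤ, u.degree < k → Polynomial.aeval θ u = 0 → ∀ n, (q : ℤ) ∣ u.coeff n)
    (r : Fin k → ℤ) (hr : ∑ j, (r j : K) *
      ((f.map (Int.castRingHom K)) /ₘ (Polynomial.X - Polynomial.C θ)).coeff j = 0) (j : Fin k) :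
    (q : ℤ) ∣ r j := by
  set u : Polynomial ℤ := ∑ j : Fin k, Polynomial.C (r j) *
    ∑ i ∈ Finset.Icc ((j : ℕ) + 1) f.natDegree, Polynomial.C (f.coeff i) *
      Polynomial.X ^ (i - ((j : ℕ) + 1)) with hu
  have hcoeff : ∀ n, u.coeff n = ∑ j : Fin k, r j * f.coeff (n + j + 1) := by
    intro n
    rw [hu, Polynomial.finsetSum_coeff]
    simp only [Polynomial.coeff_C_mul, coeff_sum_divided]
  have hdeg : u.degree < k := by
    rw [Polynomial.degree_lt_iff_coeff_zero]
    intro n hn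
    rw [hcoeff]
    refine Finset.sum_eq_zero fun i _ => ?_
    rw [Polynomial.coeff_eq_zero_of_natDegree_lt (by omega), mul_zero]
  have h0 : Polynomial.aeval θ u = 0 := by
    rw [← hr, hu, map_sum]
    refine Finset.sum_congr rfl fun i _ => ?_
    rw [Polynomial.coeff_divByMonic_X_sub_C, hfm.natDegree_map]
    simp [mul_comm]
  have hdvd := h u hdeg h0
  obtain ⟨m, hm⟩ := j
  induction m using Nat.strong_induction_on with
  | _ m ih =>
    -- The system is triangular: in this coefficient `r m` is multiplied by the leading coefficient
    -- `1` of `f`, later terms vanish, and earlier ones are divisible by induction.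
    have h1 := hdvd (k - 1 - m)
    rw [hcoeff, ← Finset.add_sum_erase _ _ (Finset.mem_univ (⟨m, hm⟩ : Fin k))] at h1
    have h2 : f.coeff (k - 1 - m + m + 1) = 1 := by
      rw [show k - 1 - m + m + 1 = f.natDegree by omega]
      exact hfm
    rw [Int.dvd_add_left] at h1
    · simpa [h2] using h1
    · refine Finset.dvd_sum fun i hi => ?_
      have hne : (i : ℕ) ≠ m := fun h => Finset.ne_of_mem_erase hi (Fin.ext h)
      rcases lt_or_gt_of_ne hne with hlt | hgt
      · exact (ih i hlt i.2).mul_right _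
      · rw [Polynomial.coeff_eq_zero_of_natDegree_lt (by omega), mul_zero]
        exact dvd_zero _

/-- The unimodular substitution `x₀, x₁ - x₀, …, xₙ - x₀`, sending `(1, …, 1)` to `(1, 0, …, 0)`. -/
noncomputable def shearedVariable (n : ℕ) (j : Fin (n + 1)) : MvPolynomial (Fin (n + 1)) ℤ :=
  Fin.cases (X 0) (fun i => X i.succ - X 0) j

theorem shearedVariable_isHomogeneous (n : ℕ) (j : Fin (n + 1)) :
    (shearedVariable n j).IsHomogeneous 1 := by
  refine Fin.cases (isHomogeneous_X ℤ 0) (fun i => ?_) j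
  exact (isHomogeneous_X ℤ i.succ).sub (isHomogeneous_X ℤ 0)

/-- The norm form of `ℤ[X] / (f)` in sheared coordinates. -/
noncomputable def shearedNormForm (n : ℕ) (f : Polynomial ℤ) : MvPolynomial (Fin (n + 1)) ℤ :=
  Polynomial.resultant (f.map C)
    (∑ j : Fin (n + 1), Polynomial.C (shearedVariable n j) * Polynomial.X ^ (j : ℕ)) (n + 1) n

theorem natDegree_sum_C_mul_X_pow_le {n : ℕ} {R : Type*} [CommRing R] (c : Fin (n + 1) → R) :
    (∑ j, Polynomial.C (c j) * Polynomial.X ^ (j : ℕ)).natDegree ≤ n :=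
  Polynomial.natDegree_sum_le_of_forall_le _ _ fun j _ =>
    (Polynomial.natDegree_C_mul_X_pow_le _ _).trans (by omega)

/-- Over an algebraically closed field, the norm form is a product of linear forms. -/
theorem map_shearedNormForm {n : ℕ} {f : Polynomial ℤ} (hfm : f.Monic) (hfd : f.natDegree = n + 1)
    {σ L : Type*} [Field L] [IsAlgClosed L]
    (φ : MvPolynomial (Fin (n + 1)) ℤ →+* MvPolynomial σ L) :
    φ (shearedNormForm n f) = ((f.map (Int.castRingHom L)).roots.map fun η =>
      ∑ j : Fin (n + 1), φ (shearedVariable n j) * C (η ^ (j : ℕ))).prod := by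
  have hf : (f.map C).map φ = (f.map (Int.castRingHom L)).map (C : L →+* MvPolynomial σ L) := by
    rw [Polynomial.map_map, Polynomial.map_map]
    congr 1
    exact RingHom.ext_int _ _
  have hm : ((f.map (Int.castRingHom L)).map (C : L →+* MvPolynomial σ L)).Monic :=
    (hfm.map _).map _
  have hd : ((f.map (Int.castRingHom L)).map (C : L →+* MvPolynomial σ L)).natDegree = n + 1 := by
    rw [(hfm.map _).natDegree_map, hfm.natDegree_map, hfd]
  have hs := IsAlgClosed.splits (f.map (Int.castRingHom L))
  rw [shearedNormForm, ← Polynomial.resultant_map_map, hf]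
  have hG : (∑ j : Fin (n + 1), Polynomial.C (shearedVariable n j) *
      Polynomial.X ^ (j : ℕ)).map φ =
      ∑ j : Fin (n + 1), Polynomial.C (φ (shearedVariable n j)) * Polynomial.X ^ (j : ℕ) := by
    simp [Polynomial.map_sum]
  rw [hG]
  have hres := Polynomial.resultant_eq_prod_eval _ _ n
    (natDegree_sum_C_mul_X_pow_le fun j => φ (shearedVariable n j))
    (hs.map (C : L →+* MvPolynomial σ L))
  rw [hd] at hres
  rw [hres, hm.leadingCoeff, one_pow, one_mul, hs.roots_map_of_injective (C_injective σ L),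
    Multiset.map_map]
  congr 2
  funext η
  simp [Polynomial.eval_finsetSum]

/-- At `(1, …, 1)` the sheared variables are `(1, 0, …, 0)`, so this is the norm of `1`. -/
theorem eval_one_shearedNormForm {n : ℕ} {f : Polynomial ℤ} (hfm : f.Monic)
    (hfd : f.natDegree = n + 1) : eval (fun _ => 1) (shearedNormForm n f) = 1 := by
  rw [shearedNormForm, ← Polynomial.resultant_map_map, Polynomial.map_map]
  have h1 : (∑ j : Fin (n + 1), Polynomial.C (shearedVariable n j) *
      Polynomial.X ^ (j : ℕ)).map (eval fun _ => (1 : ℤ)) = 1 := by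
    rw [Fin.sum_univ_succ]
    simp [shearedVariable, Polynomial.map_sum]
  rw [h1, Polynomial.resultant_one_right, ← hfd]
  simp [RingHom.ext_int _ (RingHom.id ℤ), hfm.coeff_natDegree]

theorem isHomogeneous_multiset_prod {ι σ R : Type*} [CommRing R] (s : Multiset ι)
    (φ : ι → MvPolynomial σ R) (h : ∀ i ∈ s, (φ i).IsHomogeneous 1) :
    (s.map φ).prod.IsHomogeneous (Multiset.card s) := by
  induction s using Multiset.induction_on with
  | empty => simpa using isHomogeneous_one σ R
  | cons a s ih =>
    rw [Multiset.map_cons, Multiset.prod_cons, Multiset.card_cons, add_comm]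
    exact (h a (Multiset.mem_cons_self a s)).mul (ih fun i hi => h i (Multiset.mem_cons_of_mem hi))

theorem isHomogeneous_sum_map_shearedVariable {n : ℕ} {L : Type*} [Field L] (c : Fin (n + 1) → L) :
    (∑ j, map (Int.castRingHom L) (shearedVariable n j) * C (c j)).IsHomogeneous 1 :=
  IsHomogeneous.sum _ _ _ fun j _ =>
    ((shearedVariable_isHomogeneous n j).map _).mul (isHomogeneous_C _ _)

/-- Homogeneity can be tested over `ℂ`, where the form splits into `n + 1` linear factors. -/
theorem shearedNormForm_isHomogeneous {n : ℕ} {f : Polynomial ℤ} (hfm : f.Monic)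
    (hfd : f.natDegree = n + 1) : (shearedNormForm n f).IsHomogeneous (n + 1) := by
  have h : (map (Int.castRingHom ℂ) (shearedNormForm n f)).IsHomogeneous (n + 1) := by
    rw [map_shearedNormForm hfm hfd (map (Int.castRingHom ℂ))]
    have hcard : Multiset.card (f.map (Int.castRingHom ℂ)).roots = n + 1 := by
      rw [← (IsAlgClosed.splits _).natDegree_eq_card_roots, hfm.natDegree_map, hfd]
    have hprod := isHomogeneous_multiset_prod (f.map (Int.castRingHom ℂ)).roots _ fun η _ =>
      isHomogeneous_sum_map_shearedVariable (n := n) fun j => η ^ (j : ℕ)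
    rwa [hcard] at hprod
  intro m hm
  refine h ?_
  rw [coeff_map]
  simpa using hm

/-- The point with sheared coordinates `β`. -/
def unshear {n : ℕ} {L : Type*} [Add L] (β : Fin (n + 1) → L) : Fin (n + 1) → L :=
  Fin.cases (β 0) fun i => β i.succ + β 0

theorem aeval_C_add_X_shearedVariable {n : ℕ} {L : Type*} [Field L] (β : Fin (n + 1) → L)
    (j : Fin (n + 1)) :
    aeval (fun i => C (unshear β i) + X i : Fin (n + 1) → MvPolynomial (Fin (n + 1)) L)
      (shearedVariable n j) = C (β j) + map (Int.castRingHom L) (shearedVariable n j) := by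
  refine Fin.cases ?_ (fun i => ?_) j
  · simp [shearedVariable, unshear]
  · simp only [shearedVariable, unshear, Fin.cases_succ, Fin.cases_zero, map_sub, aeval_X, map_X,
      map_add]
    ring

theorem taylorExpansionAt_shearedNormForm {n : ℕ} {f : Polynomial ℤ} (hfm : f.Monic)
    (hfd : f.natDegree = n + 1) {L : Type*} [Field L] [IsAlgClosed L] (β : Fin (n + 1) → L) :
    taylorExpansionAt (shearedNormForm n f) (unshear β) =
      ((f.map (Int.castRingHom L)).roots.map fun η =>
        C (∑ j, β j * η ^ (j : ℕ)) + ∑ j : Fin (n + 1),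
          map (Int.castRingHom L) (shearedVariable n j) * C (η ^ (j : ℕ))).prod := by
  have h := map_shearedNormForm hfm hfd (L := L)
    (aeval (fun i => C (unshear β i) + X i : Fin (n + 1) → MvPolynomial (Fin (n + 1)) L) :
      MvPolynomial (Fin (n + 1)) ℤ →ₐ[ℤ] MvPolynomial (Fin (n + 1)) L).toRingHom
  refine h.trans ?_
  congr 2
  funext η
  rw [map_sum, ← Finset.sum_add_distrib]
  refine Finset.sum_congr rfl fun j _ => ?_
  rw [AlgHom.toRingHom_eq_coe, RingHom.coe_coe, aeval_C_add_X_shearedVariable, map_mul]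
  ring

/-- With `h = f / (X - θ)`, the factor at a root `η` has constant term `h(η)`. This is zero at the
`n` roots of `h` and nonzero at the simple root `θ`, so the lowest term is a nonzero form of degree
`n`. -/
theorem vanishesToOrder_shearedNormForm {n : ℕ} {f : Polynomial ℤ} (hfm : f.Monic)
    (hfd : f.natDegree = n + 1) {L : Type*} [Field L] [IsAlgClosed L] {θ : L}
    (hθ : Polynomial.aeval θ f = 0) (hθ' : Polynomial.aeval θ f.derivative ≠ 0) :
    let β : Fin (n + 1) → L := fun j =>
      ((f.map (Int.castRingHom L)) /ₘ (Polynomial.X - Polynomial.C θ)).coeff j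
    VanishesToOrder (shearedNormForm n f) (unshear β) n ∧
      ¬ VanishesToOrder (shearedNormForm n f) (unshear β) (n + 1) := by
  intro β
  set fL := f.map (Int.castRingHom L) with hfL
  have hfLm : fL.Monic := hfm.map _
  set h := fL /ₘ (Polynomial.X - Polynomial.C θ) with hh
  have hroot : fL.IsRoot θ := by
    rw [Polynomial.IsRoot, hfL, ← algebraMap_int_eq, Polynomial.eval_map_algebraMap, hθ]
  have hmul : (Polynomial.X - Polynomial.C θ) * h = fL :=
    Polynomial.mul_divByMonic_eq_iff_isRoot.2 hroot
  have hhd : h.natDegree = n := by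
    rw [hh, Polynomial.natDegree_divByMonic _ (Polynomial.monic_X_sub_C θ), hfm.natDegree_map, hfd,
      Polynomial.natDegree_X_sub_C]
    rfl
  have hβ : ∀ η, ∑ j, β j * η ^ (j : ℕ) = h.eval η := by
    intro η
    rw [Polynomial.eval_eq_sum_range' (n := n + 1) (by omega), Finset.sum_range]
  have hroots : fL.roots = θ ::ₘ h.roots := by
    rw [← hmul, Polynomial.roots_mul (by rw [hmul]; exact hfLm.ne_zero),
      Polynomial.roots_X_sub_C, Multiset.singleton_add]
  have hhθ : h.eval θ ≠ 0 := by
    intro h0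
    apply hθ'
    have h1 : fL.derivative.eval θ = 0 := by
      rw [← hmul]
      simp [h0]
    rwa [hfL, Polynomial.derivative_map, ← algebraMap_int_eq, Polynomial.eval_map_algebraMap] at h1
  set ℓ : L → MvPolynomial (Fin (n + 1)) L := fun η =>
    ∑ j : Fin (n + 1), map (Int.castRingHom L) (shearedVariable n j) * C (η ^ (j : ℕ)) with hℓ
  have hℓhom : ∀ η, (ℓ η).IsHomogeneous 1 := fun η =>
    isHomogeneous_sum_map_shearedVariable fun j => η ^ (j : ℕ)
  set M := (h.roots.map ℓ).prod with hM
  have hMhom : M.IsHomogeneous n := by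
    have hcard : Multiset.card h.roots = n := by
      rw [← (IsAlgClosed.splits h).natDegree_eq_card_roots, hhd]
    have := isHomogeneous_multiset_prod h.roots ℓ fun η _ => hℓhom η
    rwa [hcard] at this
  have hM0 : M ≠ 0 := by
    have hℓ1 : ∀ η, eval (fun _ => (1 : L)) (ℓ η) = 1 := by
      intro η
      rw [hℓ, map_sum, Fin.sum_univ_succ]
      simp [shearedVariable]
    have h1 : eval (fun _ => (1 : L)) M = 1 := by
      rw [hM, map_multiset_prod, Multiset.map_map]
      simp [hℓ1]
    intro h0
    rw [h0] at h1
    simp at h1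
  have htaylor : taylorExpansionAt (shearedNormForm n f) (unshear β) =
      C (h.eval θ) * M + ℓ θ * M := by
    rw [taylorExpansionAt_shearedNormForm hfm hfd, ← hfL, hroots, Multiset.map_cons,
      Multiset.prod_cons, hβ, ← add_mul]
    congr 2
    refine Multiset.map_congr rfl fun η hη => ?_
    rw [hβ, (Polynomial.mem_roots'.1 hη).2, map_zero, zero_add]
  have hcoeff : ∀ m : Fin (n + 1) →₀ ℕ, m.degree ≠ n + 1 →
      coeff m (taylorExpansionAt (shearedNormForm n f) (unshear β)) = h.eval θ * coeff m M := by
    intro m hm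
    rw [htaylor, coeff_add, coeff_C_mul, ((hℓhom θ).mul hMhom).coeff_eq_zero (by omega), add_zero]
  refine ⟨fun m hm => ?_, fun hv => ?_⟩
  · rw [hcoeff m (by omega), hMhom.coeff_eq_zero (by omega), mul_zero]
  · obtain ⟨m, hm⟩ := MvPolynomial.ne_zero_iff.1 hM0
    have hmd : m.degree = n := by
      by_contra h'
      exact hm (hMhom.coeff_eq_zero h')
    have h1 := hv m (by omega)
    rw [hcoeff m (by omega)] at h1
    exact (mul_ne_zero hhθ hm) h1

/-- Without the strict inequality on the order of vanishing there need be no primitive linear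
relation. -/
theorem exists_sharp_form (K : Type*) [Field K] [IsAlgClosed K] (n : ℕ) :
    ∃ (α : Fin (n + 1) → K) (P : MvPolynomial (Fin (n + 1)) ℤ),
      P.IsHomogeneous P.totalDegree ∧ P.totalDegree = n + 1 ∧ VanishesToOrder P α n ∧
      ¬ VanishesToOrder P α (n + 1) ∧ eval (fun _ => 1) P = 1 ∧
      ¬ HasPrimitiveLinearRelation α := by
  obtain ⟨q, hq, f, θ, hfm, hfd, hθ, hθ', hgen⟩ := exists_generic_root K (n + 1) (by omega)
  obtain ⟨hv, hv'⟩ := vanishesToOrder_shearedNormForm hfm hfd hθ hθ'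
  have h1 := eval_one_shearedNormForm hfm hfd
  have hhom := shearedNormForm_isHomogeneous hfm hfd
  have hd : (shearedNormForm n f).totalDegree = n + 1 := hhom.totalDegree (by
    intro h0
    rw [h0] at h1
    simp at h1)
  refine ⟨_, shearedNormForm n f, by rwa [hd], hd, hv, hv', h1, ?_⟩
  rw [hasPrimitiveLinearRelation_iff]
  rintro ⟨r, hr, hr1⟩
  -- In sheared coordinates the coefficient of `β 0` is the sum of all `r i`, namely `1`.
  have h0 := dvd_of_sum_coeff_divByMonic_eq_zero hfm hfd hgen (Fin.cases 1 fun i => r i.succ) (by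
    rw [← hr, Fin.sum_univ_succ, Fin.sum_univ_succ]
    rw [Fin.sum_univ_succ] at hr1
    have hr2 := congrArg (Int.cast : ℤ → K) hr1
    push_cast at hr2
    simp only [unshear, Fin.cases_zero, Fin.cases_succ, zsmul_eq_mul, mul_add,
      Finset.sum_add_distrib, ← Finset.sum_mul, Int.cast_one, ← hr2]
    ring) 0
  exact hq.one_lt.ne' (by simpa using Int.natAbs_dvd_natAbs.2 h0)

theorem mainTheorem6 (F : Type*) [Field F] (k : ℕ) (hk : 1 ≤ k) :
    -- the lemma
    (∀ (α : Fin k → AlgebraicClosure F) (P : MvPolynomial (Fin k) ℤ),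
      P.IsHomogeneous P.totalDegree →
      (∃ v : ℕ, ((k : ℚ) - 1) / k * P.totalDegree < v ∧ VanishesToOrder P α v) →
      MvPolynomial.eval (fun _ => 1) P = 1 →
      HasPrimitiveLinearRelation α) ∧
    -- sharpness: order exactly `k - 1 = ((k - 1) / k) * deg P` does not suffice
    (∃ (α : Fin k → AlgebraicClosure F) (P : MvPolynomial (Fin k) ℤ),
      P.IsHomogeneous P.totalDegree ∧ P.totalDegree = k ∧
      VanishesToOrder P α (k - 1) ∧ ¬ VanishesToOrder P α k ∧
      MvPolynomial.eval (fun _ => 1) P = 1 ∧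
      ¬ HasPrimitiveLinearRelation α) := by
  obtain ⟨n, rfl⟩ : ∃ n, k = n + 1 := ⟨k - 1, by omega⟩
  refine ⟨fun α P hP ⟨v, hv, hα⟩ hP1 => ?_, exists_sharp_form _ n⟩
  -- The remaining goal is the order bound cleared of its denominator and of subtraction.
  refine hasPrimitiveLinearRelation_of_vanishesToOrder hk hP ?_ hα hP1
  push_cast at hv
  rw [add_sub_cancel_right, div_mul_eq_mul_div, div_lt_iff₀ (by positivity)] at hv
  have h : n * P.totalDegree < v * (n + 1) := by exact_mod_cast hv
  nlinarith
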